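/- Let $q>1$ be an integer and let $\chi_q$ be a real primitive Dirichlet character modulo $q$ (that is, a primitive character all of whose values are real). 1. If $\chi_q(-1)=1$, then $$\sum_{k=1}^{q-1}\chi_q(k)\,e^{k/q}=2(e-1)\sqrt q\,\sum_{n=1}^{\infty}\frac{\chi_q(n)}{1+4\pi^2n^2},$$ where the series converges absolutely. 2. If $\chi_q(-1)=-1$, then $$\sum_{k=1}^{q-1}\chi_q(k)\,e^{k/q}=-4\pi(e-1)\sqrt q\,\sum_{n=1}^{\infty}\frac{n\,\chi_q(n)}{1+4\pi^2n^2},$$ where the series converges as the limit of its partial sums $\sum_{n=1}^{N}$ as $N\to\infty$. -/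

import Mathlib

open Filter Topology

/-!
The function `exp` on the unit interval has Fourier coefficients `(e - 1) / (1 - 2πin)`, and its
symmetric Fourier sums converge to `exp x` at every interior point
(`tendsto_symmetric_fourier_sum_exp`). Multiplying by `χ k`, taking `x = k / q` and summing over `k`
replaces each exponential `exp (2πi n k / q)` by `χ n` times the Gauss sum `τ` of `χ`, because `χ` is
primitive and real, while the constant term disappears. Pairing the frequencies `n` and `-n` turns
`1 / (1 - 2πin) + χ (-1) / (1 + 2πin)` into `2 / (1 + 4π²n²)` for an even character and into
`4πin / (1 + 4π²n²)` for an odd one. Both formulas follow once `τ` is known to be `√q` for even and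
`i√q` for odd `χ` (`gaussSum_of_real_of_isPrimitive`).

Pointwise convergence is obtained from the Riemann-Lebesgue lemma: dividing `f - f x₀` by
`exp (2πix) - exp (2πix₀)` makes the partial sums telescope. No summability of the Fourier series is
used, so the conditionally convergent odd case needs no separate treatment.

The identity `τ ^ 2 = χ (-1) q` leaves the sign of `τ` open. The sign is found in three stages.
* For an odd prime `p`, the Gauss sum of the quadratic character is `∑ exp (2πi r² / p)`, and this sum
  is evaluated by comparing the two sides of the Poisson summation formula for `∑ exp (-π a n²)` as
  `a` approaches `-2i / p` (`sum_exp_sq_eq`).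
* For odd `q`, a real primitive character is the Jacobi symbol, `q` being squarefree. Gauss sums are
  multiplicative up to the factors `χ₁ b` and `χ₂ a` (`gaussSum_mul_of_coprime`), whose product is
  given by quadratic reciprocity (`jacobiSym_and_gaussSum_of_odd`).
* In general `q` is odd, or four or eight times an odd number, and the finitely many real primitive
  characters modulo `4` and `8` are treated explicitly.
-/

/-! ### Pointwise convergence of symmetric Fourier sums -/

/-- The Fourier coefficients of a function continuous on `[0, 1]` tend to zero along every sequence
of frequencies tending to infinity. -/
theorem tendsto_fourierIntegral_unitInterval {g : ℝ → ℂ} {u : ℕ → ℝ}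
    (hu : Tendsto u atTop (cocompact ℝ)) :
    Tendsto (fun N => ∫ x in (0 : ℝ)..1, g x * Complex.exp (-(2 * Real.pi * Complex.I * u N * x)))
      atTop (𝓝 0) := by
  have h := (Real.tendsto_integral_exp_smul_cocompact
    (Set.indicator (Set.Ioc (0 : ℝ) 1) g)).comp hu
  refine h.congr fun N => ?_
  rw [intervalIntegral.integral_of_le zero_le_one,
    ← MeasureTheory.integral_indicator measurableSet_Ioc]
  refine MeasureTheory.integral_congr_ae (Eventually.of_forall fun x => ?_)
  by_cases hx : x ∈ Set.Ioc (0 : ℝ) 1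
  · simp only [Set.indicator_of_mem hx, Circle.smul_def, Real.fourierChar_apply, smul_eq_mul]
    rw [mul_comm]
    congr 2
    push_cast
    ring
  · simp [Set.indicator_of_notMem hx]

theorem integral_exp_two_pi_I_int {n : ℤ} (hn : n ≠ 0) :
    ∫ x in (0 : ℝ)..1, Complex.exp (-(2 * Real.pi * Complex.I * n * x)) = 0 := by
  have hc : -(2 * Real.pi * Complex.I * n) ≠ 0 := by
    simp [Real.pi_ne_zero, hn]
  have := integral_exp_mul_complex (a := 0) (b := 1) hc
  simp only [← neg_mul] at *
  rw [this]
  have h1 : Complex.exp (-2 * Real.pi * Complex.I * n * (1 : ℝ)) = 1 := by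
    rw [Complex.exp_eq_one_iff]
    exact ⟨-n, by push_cast; ring⟩
  rw [h1]
  simp

/-- Dini's criterion for a differentiable function at an interior point: with
`E x = exp (2πix)`, the quotient `g = (f - f x₀) / (E - E x₀)` is continuous on `[0, 1]`, so that the
Fourier coefficients of `f - f x₀` are differences of consecutive Fourier coefficients of `g`; the
partial sums telescope and the Riemann-Lebesgue lemma applies. -/
theorem tendsto_symmetric_fourier_sum {f : ℝ → ℂ} (hf : Differentiable ℝ f) {x₀ : ℝ}
    (hx₀ : x₀ ∈ Set.Ioo (0 : ℝ) 1) (c : ℤ → ℂ)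
    (hc : ∀ n : ℤ, c n = ∫ x in (0 : ℝ)..1, f x * Complex.exp (-(2 * Real.pi * Complex.I * n * x))) :
    Tendsto (fun N : ℕ => c 0 + ∑ n ∈ Finset.Icc 1 N,
        (c n * Complex.exp (2 * Real.pi * Complex.I * n * x₀) +
          c (-n) * Complex.exp (-(2 * Real.pi * Complex.I * n * x₀)))) atTop (𝓝 (f x₀)) := by
  set E : ℝ → ℂ := fun x => Complex.exp (2 * Real.pi * Complex.I * x) with hE
  have hdE : ∀ x : ℝ, HasDerivAt E (Complex.exp (2 * Real.pi * Complex.I * x) *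
      (2 * Real.pi * Complex.I)) x := by
    intro x
    have h1 : HasDerivAt (fun x : ℝ => 2 * Real.pi * Complex.I * (x : ℂ))
        (2 * Real.pi * Complex.I) x := by
      simpa using (Complex.ofRealCLM.hasDerivAt (x := x)).const_mul (2 * Real.pi * Complex.I)
    exact h1.cexp
  have hEd : Differentiable ℝ E := fun x => (hdE x).differentiableAt
  have hcont : ∀ {h : ℝ → ℂ}, Differentiable ℝ h → Continuous (dslope h x₀) := by
    intro h hh
    rw [continuous_iff_continuousAt]
    intro y
    rcases eq_or_ne y x₀ with rfl | hy
    · exact continuousAt_dslope_same.2 (hh y)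
    · exact (continuousAt_dslope_of_ne hy).2 (hh y).continuousAt
  have hne : ∀ x ∈ Set.Icc (0 : ℝ) 1, dslope E x₀ x ≠ 0 := by
    intro x hx h0
    rcases eq_or_ne x x₀ with rfl | hxx
    · rw [dslope_same, (hdE x).deriv] at h0
      simp [Real.pi_ne_zero] at h0
    · have h1 := sub_smul_dslope E x₀ x
      rw [h0, smul_zero] at h1
      have h2 : E x = E x₀ := (sub_eq_zero.1 h1.symm)
      rw [hE] at h2
      obtain ⟨n, hn⟩ := Complex.exp_eq_exp_iff_exists_int.1 h2
      have h3 : (x : ℂ) = x₀ + n := by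
        have : (2 * Real.pi * Complex.I) ≠ 0 := by simp [Real.pi_ne_zero]
        apply mul_left_cancel₀ this
        rw [hn]; ring
      have h4 : x = x₀ + n := by exact_mod_cast h3
      have h5 : ((n : ℤ) : ℝ) < 1 := by linarith [hx.2, hx₀.1]
      have h6 : (-1 : ℝ) < n := by linarith [hx.1, hx₀.2]
      have h7 : n < 1 := by exact_mod_cast h5
      have h8 : -1 < n := by exact_mod_cast h6
      have h9 : n = 0 := by omega
      exact hxx (by rw [h4, h9]; simp)
  set g : ℝ → ℂ := fun x => dslope f x₀ x / dslope E x₀ x with hg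
  have hgc : ContinuousOn g (Set.Icc 0 1) :=
    (hcont hf).continuousOn.div (hcont hEd).continuousOn hne
  have hfg : ∀ x ∈ Set.Icc (0 : ℝ) 1, f x - f x₀ = g x * (E x - E x₀) := by
    intro x hx
    rw [← sub_smul_dslope f x₀ x, ← sub_smul_dslope E x₀ x, hg]
    simp only [Complex.real_smul]
    field_simp [hne x hx]
  -- the Fourier coefficients of `g`
  set G : ℤ → ℂ := fun n =>
    ∫ x in (0 : ℝ)..1, g x * Complex.exp (-(2 * Real.pi * Complex.I * n * x)) with hG
  have hint : ∀ n : ℤ, IntervalIntegrable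
      (fun x : ℝ => g x * Complex.exp (-(2 * Real.pi * Complex.I * n * x)))
      MeasureTheory.volume 0 1 := by
    intro n
    apply ContinuousOn.intervalIntegrable
    rw [Set.uIcc_of_le zero_le_one]
    exact hgc.mul (by fun_prop)
  have hkey : ∀ n : ℤ, c n - f x₀ * (∫ x in (0 : ℝ)..1,
      Complex.exp (-(2 * Real.pi * Complex.I * n * x))) = G (n - 1) - E x₀ * G n := by
    intro n
    rw [hc, ← intervalIntegral.integral_const_mul, ← intervalIntegral.integral_sub, hG]
    rotate_left
    · have := hf.continuous
      exact Continuous.intervalIntegrable (by fun_prop) _ _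
    · exact Continuous.intervalIntegrable (by fun_prop) _ _
    simp only
    rw [← intervalIntegral.integral_const_mul, ← intervalIntegral.integral_sub (hint _)
      ((hint _).const_mul _)]
    refine intervalIntegral.integral_congr fun x hx => ?_
    rw [Set.uIcc_of_le zero_le_one] at hx
    rw [← sub_mul, hfg x hx, mul_sub, sub_mul]
    have : Complex.exp (-(2 * Real.pi * Complex.I * (n - 1 : ℤ) * x)) =
        E x * Complex.exp (-(2 * Real.pi * Complex.I * n * x)) := by
      rw [hE, ← Complex.exp_add]
      congr 1
      push_cast
      ring
    rw [this]
    ring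
  -- the sequence whose differences are the terms of the Fourier series of `f - f x₀`
  set u : ℤ → ℂ := fun n => Complex.exp (2 * Real.pi * Complex.I * n * x₀) * G (n - 1) with hu
  have hterm : ∀ n : ℤ, n ≠ 0 →
      c n * Complex.exp (2 * Real.pi * Complex.I * n * x₀) = u n - u (n + 1) := by
    intro n hn
    have h := hkey n
    rw [integral_exp_two_pi_I_int hn, mul_zero, sub_zero] at h
    rw [h, hu]
    have : Complex.exp (2 * Real.pi * Complex.I * (n + 1 : ℤ) * x₀) =
        E x₀ * Complex.exp (2 * Real.pi * Complex.I * n * x₀) := by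
      rw [hE, ← Complex.exp_add]
      congr 1
      push_cast
      ring
    simp only [this, add_sub_cancel_right]
    ring
  have hzero : c 0 = f x₀ + (u 0 - u 1) := by
    have h := hkey 0
    simp at h
    rw [sub_eq_iff_eq_add'.1 h]
    simp [hu, hE]
  have hsum : ∀ N : ℕ, c 0 + ∑ n ∈ Finset.Icc 1 N,
        (c n * Complex.exp (2 * Real.pi * Complex.I * n * x₀) +
          c (-n) * Complex.exp (-(2 * Real.pi * Complex.I * n * x₀))) =
      f x₀ + (u (-N) - u (N + 1)) := by
    intro N
    induction N with
    | zero => simp [hzero]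
    | succ N ih =>
      rw [Finset.sum_Icc_succ_top (by omega), ← add_assoc, ih]
      have h1 := hterm (N + 1 : ℤ) (by omega)
      have h2 := hterm (-(N + 1 : ℤ)) (by omega)
      push_cast at h1 h2 ⊢
      rw [h1]
      rw [show -(2 * Real.pi * Complex.I * ((N : ℂ) + 1) * x₀) =
        2 * Real.pi * Complex.I * (-((N : ℂ) + 1)) * x₀ by ring, h2]
      rw [show -((N : ℤ) + 1) + 1 = -N by ring]
      ring
  simp_rw [hsum]
  have hbd : ∀ v : ℕ → ℤ, Tendsto (fun N => ((v N : ℤ) : ℝ)) atTop (cocompact ℝ) →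
      Tendsto (fun N => Complex.exp (2 * Real.pi * Complex.I * (v N + 1 : ℤ) * x₀) * G (v N))
        atTop (𝓝 0) := by
    intro v hv
    have h := tendsto_fourierIntegral_unitInterval (g := g) hv
    rw [tendsto_zero_iff_norm_tendsto_zero] at h ⊢
    refine h.congr fun N => ?_
    rw [norm_mul, Complex.norm_exp]
    simp [hG]
  have hA : Tendsto (fun N : ℕ => u (-N)) atTop (𝓝 0) := by
    refine (hbd (fun N => -N - 1) ?_).congr fun N => ?_
    · have : Tendsto (fun N : ℕ => -(N : ℝ) - 1) atTop atBot := by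
        simp only [sub_eq_add_neg]
        exact tendsto_atBot_add_const_right _ _ (tendsto_neg_atTop_atBot.comp tendsto_natCast_atTop_atTop)
      simpa using this.mono_right atBot_le_cocompact
    · simp [hu]
  have hB : Tendsto (fun N : ℕ => u (N + 1)) atTop (𝓝 0) := by
    refine (hbd (fun N => N) ?_).congr fun N => ?_
    · simpa using (tendsto_natCast_atTop_atTop (R := ℝ)).mono_right atTop_le_cocompact
    · simp [hu]
  simpa using (hA.sub hB).const_add (f x₀)

/-- The Fourier series of `exp` on the unit interval. -/
theorem tendsto_symmetric_fourier_sum_exp {x : ℝ} (hx : x ∈ Set.Ioo (0 : ℝ) 1) :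
    Tendsto (fun N : ℕ => ((Real.exp 1 : ℂ) - 1) + ∑ n ∈ Finset.Icc 1 N,
      (((Real.exp 1 : ℂ) - 1) / (1 - 2 * Real.pi * Complex.I * n) *
          Complex.exp (2 * Real.pi * Complex.I * n * x) +
        ((Real.exp 1 : ℂ) - 1) / (1 + 2 * Real.pi * Complex.I * n) *
          Complex.exp (-(2 * Real.pi * Complex.I * n * x)))) atTop (𝓝 (Real.exp x : ℂ)) := by
  have hf : Differentiable ℝ (fun x : ℝ => (Real.exp x : ℂ)) := fun x =>
    (Real.hasDerivAt_exp x).ofReal_comp.differentiableAt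
  have := tendsto_symmetric_fourier_sum hf hx
    (fun n => ((Real.exp 1 : ℂ) - 1) / (1 - 2 * Real.pi * Complex.I * n)) ?_
  · simpa using this
  intro n
  have h0 : (1 - 2 * Real.pi * Complex.I * n : ℂ) ≠ 0 := by
    intro h
    simpa using congrArg Complex.re h
  have h1 : Complex.exp ((1 - 2 * Real.pi * Complex.I * n) * (1 : ℝ)) = Real.exp 1 := by
    rw [Complex.ofReal_exp, Complex.exp_eq_exp_iff_exists_int]
    exact ⟨-n, by push_cast; ring⟩
  have h2 := integral_exp_mul_complex (a := 0) (b := 1) h0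
  rw [h1] at h2
  simp only [Complex.ofReal_zero, mul_zero, Complex.exp_zero] at h2
  rw [← h2]
  refine intervalIntegral.integral_congr fun x _ => ?_
  rw [Complex.ofReal_exp, ← Complex.exp_add]
  congr 1
  ring

/-! ### Quadratic exponential sums from Poisson summation -/

theorem cpow_half_ofReal_mul {r : ℝ} (hr : 0 < r) {z : ℂ} (hz : z ≠ 0) :
    ((r : ℂ) * z) ^ (1 / 2 : ℂ) = (r : ℂ) ^ (1 / 2 : ℂ) * z ^ (1 / 2 : ℂ) := by
  have hr' : (r : ℂ) ≠ 0 := by exact_mod_cast hr.ne'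
  rw [Complex.cpow_def_of_ne_zero (mul_ne_zero hr' hz), Complex.cpow_def_of_ne_zero hr',
    Complex.cpow_def_of_ne_zero hz, Complex.log_ofReal_mul hr hz, ← Complex.exp_add,
    Complex.ofReal_log hr.le]
  congr 1
  ring

theorem summable_exp_neg_pi_mul_int_sq {w : ℂ} (hw : 0 < w.re) :
    Summable (fun n : ℤ => Complex.exp (-Real.pi * w * (n : ℂ) ^ 2)) := by
  have h := (summable_jacobiTheta₂_term_iff 0 (Complex.I * w)).2 (by simpa using hw)
  refine h.congr fun n => ?_
  rw [jacobiTheta₂_term]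
  congr 1
  linear_combination (Real.pi * (n : ℂ) ^ 2 * w) * Complex.I_sq

/-- As `Re (1 / w) → ∞`, the Gaussian sum over a residue class modulo `N` is asymptotic to
`(w * N ^ 2) ^ (-1 / 2)`, whatever the class. -/
theorem tendsto_gaussian_sum_residue_class {α : Type*} {l : Filter α} [l.IsCountablyGenerated]
    {w : α → ℂ} (hw : ∀ᶠ x in l, 0 < (w x).re)
    (hw' : Tendsto (fun x => (1 / w x).re) l atTop) {N : ℕ} (hN : 0 < N) (r : ℤ) :
    Tendsto (fun x => (w x * (N : ℂ) ^ 2) ^ (1 / 2 : ℂ) *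
      ∑' k : ℤ, Complex.exp (-Real.pi * w x * ((k * N + r : ℤ) : ℂ) ^ 2)) l (𝓝 1) := by
  have hN0 : (N : ℂ) ≠ 0 := by exact_mod_cast hN.ne'
  have hpois : ∀ x, 0 < (w x).re → (w x * (N : ℂ) ^ 2) ^ (1 / 2 : ℂ) *
      ∑' k : ℤ, Complex.exp (-Real.pi * w x * ((k * N + r : ℤ) : ℂ) ^ 2) =
      ∑' m : ℤ, Complex.exp (-Real.pi / (w x * (N : ℂ) ^ 2) * (m : ℂ) ^ 2 +
        2 * Real.pi * Complex.I * r * m / N) := by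
    intro x hx
    have hw0 : w x ≠ 0 := by
      intro h
      simp [h] at hx
    have ha : 0 < (w x * (N : ℂ) ^ 2).re := by
      have : (w x * (N : ℂ) ^ 2).re = (w x).re * (N : ℝ) ^ 2 := by
        rw [show ((N : ℂ) ^ 2) = (((N : ℝ) ^ 2 : ℝ) : ℂ) by push_cast; rfl, Complex.re_mul_ofReal]
      rw [this]
      positivity
    have ha0 : w x * (N : ℂ) ^ 2 ≠ 0 := mul_ne_zero hw0 (pow_ne_zero _ hN0)
    have h := Complex.tsum_exp_neg_quadratic ha (-(w x * r * N))
    have h1 : ∀ k : ℤ, Complex.exp (-Real.pi * w x * ((k * N + r : ℤ) : ℂ) ^ 2) =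
        Complex.exp (-Real.pi * w x * r ^ 2) *
          Complex.exp (-Real.pi * (w x * (N : ℂ) ^ 2) * (k : ℂ) ^ 2 +
            2 * Real.pi * (-(w x * r * N)) * k) := by
      intro k
      rw [← Complex.exp_add]
      congr 1
      push_cast
      ring
    have h2 : ∀ m : ℤ, Complex.exp (-Real.pi / (w x * (N : ℂ) ^ 2) * (m : ℂ) ^ 2 +
        2 * Real.pi * Complex.I * r * m / N) = Complex.exp (-Real.pi * w x * r ^ 2) *
          Complex.exp (-Real.pi / (w x * (N : ℂ) ^ 2) *
            (m + Complex.I * (-(w x * r * N))) ^ 2) := by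
      intro m
      rw [← Complex.exp_add]
      congr 1
      field_simp
      linear_combination ((w x) ^ 2 * r ^ 2 * (N : ℂ) ^ 2) * Complex.I_sq
    simp_rw [h1, h2, tsum_mul_left]
    rw [h]
    have h3 : (w x * (N : ℂ) ^ 2) ^ (1 / 2 : ℂ) ≠ 0 := by
      rw [Ne, Complex.cpow_eq_zero_iff]
      exact fun h => ha0 h.1
    field_simp
  have hnorm : ∀ x (m : ℤ), ‖Complex.exp (-Real.pi / (w x * (N : ℂ) ^ 2) * (m : ℂ) ^ 2 +
        2 * Real.pi * Complex.I * r * m / N)‖ =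
      Real.exp (-Real.pi * ((1 / w x).re / (N : ℝ) ^ 2) * (m : ℝ) ^ 2) := by
    intro x m
    rw [Complex.norm_exp]
    congr 1
    have e1 : -Real.pi / (w x * (N : ℂ) ^ 2) * (m : ℂ) ^ 2 +
        2 * Real.pi * Complex.I * r * m / N =
        ((-Real.pi * (m : ℝ) ^ 2 / (N : ℝ) ^ 2 : ℝ) : ℂ) * (1 / w x) +
          ((2 * Real.pi * r * m / N : ℝ) : ℂ) * Complex.I := by
      push_cast
      field_simp
    rw [e1, Complex.add_re, Complex.re_ofReal_mul, Complex.re_ofReal_mul, Complex.I_re]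
    ring
  have hlim : Tendsto (fun x => ∑' m : ℤ, Complex.exp (-Real.pi / (w x * (N : ℂ) ^ 2) *
      (m : ℂ) ^ 2 + 2 * Real.pi * Complex.I * r * m / N)) l
      (𝓝 (∑' m : ℤ, if m = 0 then 1 else 0)) := by
    have hdiv : Tendsto (fun x => (1 / w x).re / (N : ℝ) ^ 2) l atTop :=
      hw'.atTop_div_const (by positivity)
    refine tendsto_tsum_of_dominated_convergence
      (bound := fun m : ℤ => ‖Complex.exp (-Real.pi * 1 * (m : ℂ) ^ 2)‖)
      (summable_exp_neg_pi_mul_int_sq (by simp)).norm ?_ ?_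
    · intro m
      split_ifs with hm
      · simpa [hm] using tendsto_const_nhds
      · rw [tendsto_zero_iff_norm_tendsto_zero]
        simp_rw [hnorm]
        refine Real.tendsto_exp_atBot.comp ?_
        have hm2 : 0 < (m : ℝ) ^ 2 := by positivity
        have := (hdiv.const_mul_atTop (mul_pos Real.pi_pos hm2))
        refine (tendsto_neg_atTop_atBot.comp this).congr fun x => ?_
        simp only [Function.comp]
        ring
    · filter_upwards [hdiv.eventually_ge_atTop 1] with x hx m
      rw [hnorm, Complex.norm_exp]
      have e2 : (-Real.pi * 1 * (m : ℂ) ^ 2 : ℂ) = ((-Real.pi * (m : ℝ) ^ 2 : ℝ) : ℂ) := by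
        push_cast
        ring
      rw [e2, Complex.ofReal_re, Real.exp_le_exp]
      have : 0 ≤ Real.pi * (m : ℝ) ^ 2 := by positivity
      nlinarith
  rw [tsum_ite_eq] at hlim
  refine hlim.congr' ?_
  filter_upwards [hw] with x hx
  rw [hpois x hx]

/-- As `Re (1 / w) → ∞`, a Gaussian sum weighted by a periodic sequence sees only the sum of the
sequence over a period. -/
theorem tendsto_gaussian_sum_periodic {α : Type*} {l : Filter α} [l.IsCountablyGenerated]
    {w : α → ℂ} (hw : ∀ᶠ x in l, 0 < (w x).re)
    (hw' : Tendsto (fun x => (1 / w x).re) l atTop) {N : ℕ} (hN : 0 < N) {c : ℤ → ℂ}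
    (hc : ∀ k r : ℤ, c (k * N + r) = c r) :
    Tendsto (fun x => (w x * (N : ℂ) ^ 2) ^ (1 / 2 : ℂ) *
      ∑' n : ℤ, c n * Complex.exp (-Real.pi * w x * (n : ℂ) ^ 2)) l
      (𝓝 (∑ r ∈ Finset.range N, c r)) := by
  have : NeZero N := ⟨hN.ne'⟩
  have h := tendsto_finsetSum (Finset.range N) fun r _ =>
    (tendsto_gaussian_sum_residue_class hw hw' hN (r : ℤ)).const_mul (c r)
  simp only [mul_one] at h
  refine h.congr' ?_
  filter_upwards [hw] with x hx
  set F : ℤ → ℂ := fun n => Complex.exp (-Real.pi * w x * (n : ℂ) ^ 2) with hF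
  have hs : Summable F := summable_exp_neg_pi_mul_int_sq hx
  have hs1 : Summable fun p : ℤ × Fin N => F (p.1 * N + ((p.2 : ℕ) : ℤ)) :=
    (Int.divModEquiv N).symm.summable_iff.2 hs
  have hs2 : ∀ r : Fin N, Summable fun k : ℤ => F (k * N + ((r : ℕ) : ℤ)) := fun r =>
    hs1.comp_injective (i := fun k : ℤ => (k, r)) fun a b hab => congrArg Prod.fst hab
  have key : ∑' n : ℤ, c n * F n =
      ∑ r : Fin N, c ((r : ℕ) : ℤ) * ∑' k : ℤ, F (k * N + ((r : ℕ) : ℤ)) := by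
    rw [← (Int.divModEquiv N).symm.tsum_eq]
    have e : ∀ p : ℤ × Fin N, c ((Int.divModEquiv N).symm p) * F ((Int.divModEquiv N).symm p) =
        c ((p.2 : ℕ) : ℤ) * F (p.1 * N + ((p.2 : ℕ) : ℤ)) := by
      intro p
      rw [Int.divModEquiv_symm_apply, hc]
    simp_rw [e]
    have hsm : Summable
        (fun p : Fin N × ℤ => c ((p.1 : ℕ) : ℤ) * F (p.2 * N + ((p.1 : ℕ) : ℤ))) := by
      obtain ⟨C, hC⟩ := (Set.finite_range fun r : Fin N => ‖c ((r : ℕ) : ℤ)‖).bddAbove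
      have hs3 := ((Equiv.prodComm (Fin N) ℤ).summable_iff.2 hs1).norm
      refine Summable.of_norm_bounded (hs3.mul_left C) fun p => ?_
      rw [norm_mul]
      exact mul_le_mul_of_nonneg_right (hC ⟨p.1, rfl⟩) (norm_nonneg _)
    have hfib := hsm.hasSum.prod_fiberwise fun r => (hs2 r).hasSum.mul_left (c ((r : ℕ) : ℤ))
    rw [← (Equiv.prodComm (Fin N) ℤ).tsum_eq]
    exact hfib.unique (hasSum_fintype _)
  rw [key, Finset.mul_sum, ← Fin.sum_univ_eq_sum_range (fun r : ℕ => c (r : ℤ) *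
    ((w x * (N : ℂ) ^ 2) ^ (1 / 2 : ℂ) * ∑' k : ℤ, F (k * N + (r : ℤ))))]
  refine Finset.sum_congr rfl fun r _ => by ring

/-- The evaluation of the quadratic Gauss sum. The two sides arise from the behaviour of
`∑ exp (-π a n²)` and of its Poisson dual `∑ exp (-π n² / a)` as `a = ε - 2i / N` approaches
`-2i / N`: the first sum carries the weight `exp (2πi n² / N)`, of period `N`, the second one the
weight `exp (-πi n² N / 2)`, of period `2`. -/
theorem sum_exp_sq_eq {N : ℕ} (hN : 0 < N) :
    ∑ r ∈ Finset.range N, Complex.exp (2 * Real.pi * Complex.I * (r : ℂ) ^ 2 / N) =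
      (1 + (-Complex.I) ^ N) / (-2 * Complex.I / N) ^ (1 / 2 : ℂ) := by
  have hN0 : (N : ℂ) ≠ 0 := by exact_mod_cast hN.ne'
  set l : Filter ℝ := 𝓝[>] 0
  set a : ℝ → ℂ := fun ε => ε - 2 * Complex.I / N with ha
  set ρ : ℝ → ℂ := fun ε => 1 / (1 + Complex.I * ε * N / 2) with hρ
  set w : ℝ → ℂ := fun ε => ε * (N : ℂ) ^ 2 / 4 * ρ ε with hw
  have hare : ∀ ε, (a ε).re = ε := by
    intro ε
    have : a ε = ε + ((-2 / N : ℝ) : ℂ) * Complex.I := by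
      rw [ha]
      push_cast
      ring
    rw [this]
    simp
  have hden : ∀ ε : ℝ, (1 + Complex.I * ε * N / 2 : ℂ) ≠ 0 := by
    intro ε h
    have : (1 + Complex.I * ε * N / 2 : ℂ) = 1 + ((ε * N / 2 : ℝ) : ℂ) * Complex.I := by
      push_cast
      ring
    rw [this] at h
    simpa using congrArg Complex.re h
  have hρ0 : ∀ ε, ρ ε ≠ 0 := fun ε => one_div_ne_zero (hden ε)
  have hpos : ∀ᶠ ε in l, 0 < ε := eventually_mem_nhdsWithin
  -- the two Gaussian parameters are related by `1 / a = iN / 2 + w`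
  have hinv : ∀ ε, 0 < ε → 1 / a ε = Complex.I * N / 2 + w ε := by
    intro ε hε
    have ha0 : a ε ≠ 0 := by
      intro h
      have := hare ε
      rw [h] at this
      simp at this
      linarith
    have h1 := hden ε
    have h2 : a ε = -2 * Complex.I / N * (1 + Complex.I * ε * N / 2) := by
      rw [ha]
      field_simp
      linear_combination (N : ℂ) * ε * Complex.I_sq
    have h3 : w ε * (1 + Complex.I * ε * N / 2) = ε * (N : ℂ) ^ 2 / 4 := by
      rw [hw, hρ]
      simp only
      rw [mul_assoc, one_div, inv_mul_cancel₀ h1, mul_one]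
    have h4 : w ε * a ε = -Complex.I * ε * N / 2 := by
      rw [h2, mul_left_comm, h3]
      field_simp
      ring
    rw [div_eq_iff ha0, add_mul, h4, ha]
    field_simp
    linear_combination 2 * Complex.I_sq
  have hwinv : ∀ ε : ℝ, 0 < ε → (1 / w ε).re = 4 / (N : ℝ) ^ 2 * ε⁻¹ := by
    intro ε hε
    have hε0 : (ε : ℂ) ≠ 0 := by exact_mod_cast hε.ne'
    have : 1 / w ε = ((4 / (N : ℝ) ^ 2 * ε⁻¹ : ℝ) : ℂ) + ((2 / N : ℝ) : ℂ) * Complex.I := by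
      have h1 := hden ε
      rw [hw, hρ]
      push_cast
      field_simp
      ring
    rw [this, Complex.add_re, Complex.re_ofReal_mul, Complex.ofReal_re]
    simp
  have hwtop : Tendsto (fun ε => (1 / w ε).re) l atTop := by
    have : Tendsto (fun ε : ℝ => 4 / (N : ℝ) ^ 2 * ε⁻¹) l atTop :=
      tendsto_inv_nhdsGT_zero.const_mul_atTop (by positivity)
    refine this.congr' ?_
    filter_upwards [hpos] with ε hε
    rw [hwinv ε hε]
  have hwpos : ∀ ε, 0 < ε → 0 < (w ε).re := by
    intro ε hε
    have h1 : 0 < (1 / w ε).re := by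
      rw [hwinv ε hε]
      positivity
    rw [one_div, Complex.inv_re] at h1
    by_contra h2
    exact absurd h1 (not_lt.2 (div_nonpos_of_nonpos_of_nonneg (not_lt.1 h2) (Complex.normSq_nonneg _)))
  -- the sum with weight of period `N`
  have hL := tendsto_gaussian_sum_periodic (l := l) (w := fun ε : ℝ => (ε : ℂ)) (N := N)
    (c := fun n : ℤ => Complex.exp (2 * Real.pi * Complex.I * (n : ℂ) ^ 2 / N))
    (by simpa using hpos) (by
      refine tendsto_inv_nhdsGT_zero.congr fun ε => ?_
      rw [← Complex.ofReal_one, ← Complex.ofReal_div, Complex.ofReal_re, one_div]) hN (by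
      intro k r
      rw [Complex.exp_eq_exp_iff_exists_int]
      refine ⟨k ^ 2 * N + 2 * k * r, ?_⟩
      push_cast
      field_simp
      ring)
  -- the sum with weight of period `2`
  have hR := tendsto_gaussian_sum_periodic (l := l) (w := w) (N := 2)
    (c := fun n : ℤ => Complex.exp (-Real.pi * Complex.I * N * (n : ℂ) ^ 2 / 2))
    (by filter_upwards [hpos] with ε hε using hwpos ε hε) hwtop two_pos (by
      intro k r
      rw [Complex.exp_eq_exp_iff_exists_int]
      refine ⟨-(N * (k ^ 2 + k * r)), ?_⟩
      push_cast
      ring)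
  have hρlim : Tendsto (fun ε => (ρ ε) ^ (1 / 2 : ℂ)) l (𝓝 1) := by
    have h1 : Tendsto ρ l (𝓝 1) := by
      have : ContinuousAt ρ 0 := by
        rw [hρ]
        exact ContinuousAt.div (by fun_prop) (by fun_prop) (hden 0)
      have h2 := this.tendsto.mono_left (nhdsWithin_le_nhds (s := Set.Ioi 0))
      simpa [hρ] using h2
    have h2 := h1.cpow (tendsto_const_nhds (x := (1 / 2 : ℂ))) (by simp [Complex.slitPlane])
    simpa using h2
  have halim : Tendsto (fun ε => (a ε) ^ (1 / 2 : ℂ)) l (𝓝 ((-2 * Complex.I / N) ^ (1 / 2 : ℂ))) := by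
    have h1 : Tendsto a l (𝓝 (-2 * Complex.I / N)) := by
      have : ContinuousAt a 0 := by
        rw [ha]
        fun_prop
      have h2 := this.tendsto.mono_left (nhdsWithin_le_nhds (s := Set.Ioi 0))
      convert h2 using 2
      rw [ha]
      simp [neg_div]
    refine h1.cpow tendsto_const_nhds ?_
    right
    have : (-2 * Complex.I / N : ℂ) = ((-2 / N : ℝ) : ℂ) * Complex.I := by
      push_cast
      ring
    rw [this, Complex.im_ofReal_mul]
    simp [hN.ne']
  have hane : (-2 * Complex.I / N : ℂ) ^ (1 / 2 : ℂ) ≠ 0 := by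
    rw [Ne, Complex.cpow_eq_zero_iff]
    simp [hN.ne']
  -- by Poisson summation, dividing the second sum by `√a` and `√ρ` gives the first one
  have hT := (hR.div halim hane).div hρlim one_ne_zero
  have hsum2 : ∑ r ∈ Finset.range 2,
      Complex.exp (-Real.pi * Complex.I * N * (((r : ℕ) : ℤ) : ℂ) ^ 2 / 2) =
      1 + (-Complex.I) ^ N := by
    have : Complex.exp (-Real.pi * Complex.I * N / 2) = (-Complex.I) ^ N := by
      rw [← Complex.exp_neg_pi_div_two_mul_I, ← Complex.exp_nat_mul]
      congr 1
      ring
    simp [Finset.sum_range_succ, ← this]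
  rw [hsum2, div_one] at hT
  have heq := tendsto_nhds_unique_of_eventuallyEq hL hT ?_
  · simpa using heq
  filter_upwards [hpos] with ε hε
  have hε0 : (ε : ℂ) ≠ 0 := by exact_mod_cast hε.ne'
  have e1 : ∀ n : ℤ, Complex.exp (2 * Real.pi * Complex.I * (n : ℂ) ^ 2 / N) *
      Complex.exp (-Real.pi * ε * (n : ℂ) ^ 2) = Complex.exp (-Real.pi * a ε * (n : ℂ) ^ 2) := by
    intro n
    rw [← Complex.exp_add, ha]
    congr 1
    ring
  have e2 : ∀ n : ℤ, Complex.exp (-Real.pi * Complex.I * N * (n : ℂ) ^ 2 / 2) *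
      Complex.exp (-Real.pi * w ε * (n : ℂ) ^ 2) =
      Complex.exp (-Real.pi / a ε * (n : ℂ) ^ 2) := by
    intro n
    rw [← Complex.exp_add, div_eq_mul_one_div (-(Real.pi : ℂ)) (a ε), hinv ε hε]
    congr 1
    ring
  simp only [Pi.div_apply]
  simp_rw [e1, e2]
  rw [Complex.tsum_exp_neg_mul_int_sq (by rw [hare]; exact hε)]
  have e3 : w ε * ((2 : ℕ) : ℂ) ^ 2 = ((ε * (N : ℝ) ^ 2 : ℝ) : ℂ) * ρ ε := by
    rw [hw]
    push_cast
    ring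
  rw [e3, cpow_half_ofReal_mul (by positivity) (hρ0 ε)]
  have hρ1 : ρ ε ^ (1 / 2 : ℂ) ≠ 0 := by
    rw [Ne, Complex.cpow_eq_zero_iff]
    exact fun h => hρ0 ε h.1
  push_cast
  field_simp

/-- For odd `N`, the quadratic Gauss sum is `√N` or `i√N` according to `N` modulo `4`. -/
theorem sum_exp_sq_eq_of_odd {N : ℕ} (hN : Odd N) :
    ∑ r ∈ Finset.range N, Complex.exp (2 * Real.pi * Complex.I * (r : ℂ) ^ 2 / N) =
      (if N % 4 = 1 then 1 else Complex.I) * (Real.sqrt N : ℂ) := by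
  have hN0 : 0 < N := hN.pos
  have hNr : (0 : ℝ) < N := by exact_mod_cast hN0
  -- the principal square root of `-2i / N` is `(1 - i) / √N`
  have hroot : (-2 * Complex.I / N : ℂ) ^ (1 / 2 : ℂ) = (1 - Complex.I) / (Real.sqrt N : ℂ) := by
    have hsq : (-2 * Complex.I / N : ℂ) = ((1 - Complex.I) / (Real.sqrt N : ℂ)) ^ 2 := by
      rw [div_pow, ← Complex.ofReal_pow, Real.sq_sqrt hNr.le]
      push_cast
      congr 1
      linear_combination -Complex.I_sq
    rw [hsq, one_div]
    have hre : 0 < ((1 - Complex.I) / (Real.sqrt N : ℂ)).re := by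
      rw [Complex.div_ofReal_re]
      simpa using hN0
    have harg := Complex.abs_arg_lt_pi_div_two_iff.2 (Or.inl hre)
    rw [abs_lt] at harg
    have := Complex.pow_cpow_nat_inv (n := 2) (x := (1 - Complex.I) / (Real.sqrt N : ℂ))
      two_ne_zero (by push_cast; linarith [harg.1]) (by push_cast; linarith [harg.2])
    simpa using this
  have h1I : (1 - Complex.I : ℂ) ≠ 0 := by
    intro h
    simpa using congrArg Complex.re h
  rw [sum_exp_sq_eq hN0, hroot, div_div_eq_mul_div, div_eq_iff h1I]
  obtain ⟨k, hk⟩ : ∃ k, N = 4 * k + 1 ∨ N = 4 * k + 3 := by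
    obtain ⟨m, hm⟩ := hN
    exact ⟨m / 2, by omega⟩
  have h4 : (-Complex.I : ℂ) ^ (4 * k) = 1 := by
    rw [pow_mul, neg_pow, Complex.I_pow_four]
    norm_num
  rcases hk with h | h
  · have : N % 4 = 1 := by omega
    rw [if_pos this]
    have hp : (-Complex.I : ℂ) ^ N = -Complex.I := by rw [h, pow_succ, h4, one_mul]
    rw [hp]
    ring
  · have : ¬ N % 4 = 1 := by omega
    rw [if_neg this]
    have hp : (-Complex.I : ℂ) ^ N = Complex.I := by
      rw [h, pow_add, h4, one_mul]
      linear_combination -Complex.I * Complex.I_sq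
    rw [hp]
    linear_combination (Real.sqrt N : ℂ) * Complex.I_sq

/-! ### Gauss sums of real characters: prime moduli and multiplicativity -/

theorem sum_zmod_eq_sum_range {M : Type*} [AddCommMonoid M] (n : ℕ) [NeZero n] (f : ZMod n → M) :
    ∑ x : ZMod n, f x = ∑ r ∈ Finset.range n, f (r : ZMod n) := by
  refine (Finset.sum_bij (fun (r : ℕ) _ => (r : ZMod n)) (fun _ _ => Finset.mem_univ _) ?_ ?_
    fun _ _ => rfl).symm
  · intro a ha b hb hab
    rw [ZMod.natCast_eq_natCast_iff'] at hab
    rwa [Nat.mod_eq_of_lt (Finset.mem_range.1 ha), Nat.mod_eq_of_lt (Finset.mem_range.1 hb)] at hab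
  · intro x _
    exact ⟨x.val, Finset.mem_range.2 x.val_lt, by simp⟩

/-- Counting square roots turns the exponential sum of squares modulo `p` into the Gauss sum of the
quadratic character. -/
theorem gaussSum_eq_of_eq_quadraticChar {p : ℕ} [Fact p.Prime] (hp : p ≠ 2)
    {χ : DirichletCharacter ℂ p} (hχ : ∀ a, χ a = (quadraticChar (ZMod p) a : ℂ)) :
    gaussSum χ ZMod.stdAddChar =
      (if p % 4 = 1 then 1 else Complex.I) * (Real.sqrt p : ℂ) := by
  have hodd : Odd p := (Fact.out : p.Prime).odd_of_ne_two hp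
  rw [← sum_exp_sq_eq_of_odd hodd]
  have h1 : ∀ r ∈ Finset.range p, Complex.exp (2 * Real.pi * Complex.I * (r : ℂ) ^ 2 / p) =
      ZMod.stdAddChar (((r : ℕ) : ZMod p) ^ 2) := by
    intro r _
    have := ZMod.stdAddChar_coe (N := p) ((r : ℤ) ^ 2)
    push_cast at this
    rw [this]
  rw [Finset.sum_congr rfl h1, ← sum_zmod_eq_sum_range p fun x => ZMod.stdAddChar (x ^ 2),
    ← Finset.sum_fiberwise (s := Finset.univ) (g := fun x : ZMod p => x ^ 2)]
  have h2 : ∀ a : ZMod p, ∑ x with x ^ 2 = a, (ZMod.stdAddChar (x ^ 2) : ℂ) =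
      (χ a + 1) * ZMod.stdAddChar a := by
    intro a
    have h3 : ∀ x ∈ Finset.univ.filter (fun x : ZMod p => x ^ 2 = a),
        (ZMod.stdAddChar (x ^ 2) : ℂ) = ZMod.stdAddChar a := by
      intro x hx
      rw [(Finset.mem_filter.1 hx).2]
    rw [Finset.sum_congr rfl h3, Finset.sum_const, nsmul_eq_mul, hχ]
    congr 1
    have h4 := quadraticChar_card_sqrts ((ZMod.ringChar_zmod_n p).substr hp) a
    rw [Set.toFinset_ofPred] at h4
    exact_mod_cast h4
  simp_rw [h2, add_mul, one_mul]
  rw [Finset.sum_add_distrib, AddChar.sum_eq_zero_of_ne_one, add_zero, gaussSum]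
  have := ZMod.isPrimitive_stdAddChar p one_ne_zero
  simpa using this

/-- A Dirichlet character modulo `a * b`, with `a` and `b` coprime, is a product of characters modulo
`a` and modulo `b`. If it is primitive, or real, then so are both factors. -/
theorem exists_factorization_of_coprime {a b : ℕ} [NeZero a] [NeZero b] (hab : a.Coprime b)
    {χ : DirichletCharacter ℂ (a * b)} (hprim : χ.IsPrimitive)
    (hreal : ∀ x : ZMod (a * b), (χ x).im = 0) :
    ∃ (χ₁ : DirichletCharacter ℂ a) (χ₂ : DirichletCharacter ℂ b),
      (∀ z : ℤ, χ z = χ₁ z * χ₂ z) ∧ χ₁.IsPrimitive ∧ χ₂.IsPrimitive ∧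
        (∀ x, (χ₁ x).im = 0) ∧ ∀ x, (χ₂ x).im = 0 := by
  set e := ZMod.chineseRemainder hab with he
  let U : (ZMod a)ˣ × (ZMod b)ˣ →* (ZMod (a * b))ˣ :=
    (Units.map (e.symm : ZMod a × ZMod b →* ZMod (a * b))).comp
      (MulEquiv.prodUnits (M := ZMod a) (N := ZMod b)).symm.toMonoidHom
  have hU : ∀ p, ((U p : (ZMod (a * b))ˣ) : ZMod (a * b)) = e.symm ((p.1 : ZMod a), (p.2 : ZMod b)) :=
    fun p => rfl
  set χ₁ : DirichletCharacter ℂ a :=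
    MulChar.ofUnitHom (χ.toUnitHom.comp (U.comp (MonoidHom.inl _ _))) with hχ₁
  set χ₂ : DirichletCharacter ℂ b :=
    MulChar.ofUnitHom (χ.toUnitHom.comp (U.comp (MonoidHom.inr _ _))) with hχ₂
  have h₁ : ∀ u : (ZMod a)ˣ, χ₁ u = χ (U (u, 1)) := by
    intro u
    simp [hχ₁]
  have h₂ : ∀ u : (ZMod b)ˣ, χ₂ u = χ (U (1, u)) := by
    intro u
    simp [hχ₂]
  have hfac : χ = DirichletCharacter.changeLevel (dvd_mul_right a b) χ₁ *
      DirichletCharacter.changeLevel (dvd_mul_left b a) χ₂ := by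
    ext u
    have e1 : DirichletCharacter.changeLevel (dvd_mul_right a b) χ₁ u =
        χ₁ (ZMod.unitsMap (dvd_mul_right a b) u) := by
      rw [DirichletCharacter.changeLevel_eq_cast_of_dvd, ZMod.unitsMap_val]
    have e2 : DirichletCharacter.changeLevel (dvd_mul_left b a) χ₂ u =
        χ₂ (ZMod.unitsMap (dvd_mul_left b a) u) := by
      rw [DirichletCharacter.changeLevel_eq_cast_of_dvd, ZMod.unitsMap_val]
    rw [MulChar.mul_apply, e1, e2, h₁, h₂, ← map_mul, ← Units.val_mul, ← map_mul]
    congr 1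
    rw [hU, eq_comm, e.symm_apply_eq]
    simp [he, ZMod.chineseRemainder, ZMod.unitsMap_val, Prod.ext_iff]
  -- the conductor `a * b` of the product divides the product of the conductors of the factors
  have hdvd : a * b ∣ χ₁.conductor * χ₂.conductor := by
    have h := DirichletCharacter.conductor_mul_dvd_lcm_conductor
      (DirichletCharacter.changeLevel (dvd_mul_right a b) χ₁)
      (DirichletCharacter.changeLevel (dvd_mul_left b a) χ₂)
    rw [← hfac, hprim, DirichletCharacter.conductor_changeLevel,
      DirichletCharacter.conductor_changeLevel] at h
    exact h.trans (Nat.lcm_dvd_mul _ _)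
  have hc1 := χ₁.conductor_dvd_level
  have hc2 := χ₂.conductor_dvd_level
  refine ⟨χ₁, χ₂, ?_, ?_, ?_, ?_, ?_⟩
  · intro z
    by_cases hz : IsCoprime z ((a * b : ℕ) : ℤ)
    · conv_lhs => rw [hfac]
      rw [MulChar.mul_apply, DirichletCharacter.changeLevel_eq_cast_of_dvd' _ _ hz,
        DirichletCharacter.changeLevel_eq_cast_of_dvd' _ _ hz]
    · rw [(DirichletCharacter.apply_eq_zero_iff χ z).2 hz, eq_comm, mul_eq_zero,
        DirichletCharacter.apply_eq_zero_iff, DirichletCharacter.apply_eq_zero_iff]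
      by_contra hcon
      push Not at hcon
      apply hz
      push_cast
      exact hcon.1.mul_right hcon.2
  · rw [DirichletCharacter.isPrimitive_def]
    refine Nat.dvd_antisymm hc1 ?_
    have hcop : a.Coprime χ₂.conductor := hab.coprime_dvd_right hc2
    exact hcop.dvd_of_dvd_mul_right ((dvd_mul_right a b).trans hdvd)
  · rw [DirichletCharacter.isPrimitive_def]
    refine Nat.dvd_antisymm hc2 ?_
    have hcop : b.Coprime χ₁.conductor := hab.symm.coprime_dvd_right hc1
    exact hcop.dvd_of_dvd_mul_left ((dvd_mul_left b a).trans hdvd)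
  · intro x
    by_cases hx : IsUnit x
    · obtain ⟨u, rfl⟩ := hx
      rw [h₁, hreal]
    · rw [MulChar.map_nonunit _ hx, Complex.zero_im]
  · intro x
    by_cases hx : IsUnit x
    · obtain ⟨u, rfl⟩ := hx
      rw [h₂, hreal]
    · rw [MulChar.map_nonunit _ hx, Complex.zero_im]

/-- Twisted multiplicativity of Gauss sums. -/
theorem gaussSum_mul_of_coprime {a b : ℕ} [NeZero a] [NeZero b] (hab : a.Coprime b)
    {χ : DirichletCharacter ℂ (a * b)} {χ₁ : DirichletCharacter ℂ a} {χ₂ : DirichletCharacter ℂ b}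
    (h : ∀ z : ℤ, χ z = χ₁ z * χ₂ z) :
    gaussSum χ ZMod.stdAddChar = χ₁ (b : ZMod a) * χ₂ (a : ZMod b) *
      (gaussSum χ₁ ZMod.stdAddChar * gaussSum χ₂ ZMod.stdAddChar) := by
  have ha0 : (a : ℂ) ≠ 0 := by exact_mod_cast NeZero.ne a
  have hb0 : (b : ℂ) ≠ 0 := by exact_mod_cast NeZero.ne b
  -- every residue class modulo `a * b` is `b x + a y` for unique `x` modulo `a` and `y` modulo `b`
  let φ : ZMod a × ZMod b → ZMod (a * b) := fun p =>
    ((b * p.1.val + a * p.2.val : ℤ) : ZMod (a * b))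
  have hbij : Function.Bijective φ := by
    rw [Fintype.bijective_iff_injective_and_card]
    refine ⟨?_, by simp [ZMod.card]⟩
    rintro ⟨x, y⟩ ⟨x', y'⟩ hxy
    have h1 := congrArg (ZMod.castHom (dvd_mul_right a b) (ZMod a)) hxy
    have h2 := congrArg (ZMod.castHom (dvd_mul_left b a) (ZMod b)) hxy
    simp only [φ, map_intCast] at h1 h2
    push_cast at h1 h2
    simp only [ZMod.natCast_self, zero_mul, add_zero, zero_add, ZMod.natCast_val, ZMod.cast_id',
      id_eq] at h1 h2
    have ub : IsUnit (b : ZMod a) := (ZMod.isUnit_iff_coprime b a).2 hab.symm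
    have ua : IsUnit (a : ZMod b) := (ZMod.isUnit_iff_coprime a b).2 hab
    exact Prod.ext (ub.mul_left_cancel h1) (ua.mul_left_cancel h2)
  have hterm : ∀ p : ZMod a × ZMod b, χ (φ p) * ZMod.stdAddChar (φ p) =
      χ₁ (b : ZMod a) * χ₂ (a : ZMod b) *
        ((χ₁ p.1 * ZMod.stdAddChar p.1) * (χ₂ p.2 * ZMod.stdAddChar p.2)) := by
    rintro ⟨x, y⟩
    have e1 : (ZMod.stdAddChar (φ (x, y)) : ℂ) = ZMod.stdAddChar x * ZMod.stdAddChar y := by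
      have hx := ZMod.stdAddChar_coe (N := a) (x.val : ℤ)
      have hy := ZMod.stdAddChar_coe (N := b) (y.val : ℤ)
      rw [Int.cast_natCast, ZMod.natCast_zmod_val] at hx hy
      rw [hx, hy, ← Complex.exp_add, ZMod.stdAddChar_coe]
      congr 1
      push_cast
      field_simp
    have e2 : χ (φ (x, y)) = χ₁ (b * x) * χ₂ (a * y) := by
      rw [h]
      push_cast
      simp
    rw [e1, e2, map_mul, map_mul]
    ring
  rw [gaussSum, ← Fintype.sum_bijective φ hbij (fun p => χ (φ p) * ZMod.stdAddChar (φ p)) _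
    fun _ => rfl]
  simp_rw [hterm]
  rw [← Finset.mul_sum, Fintype.sum_prod_type, gaussSum, gaussSum, Finset.sum_mul_sum]

/-! ### Structure of real primitive characters -/

theorem eq_one_or_neg_one_of_real {q : ℕ} {χ : DirichletCharacter ℂ q}
    (hreal : ∀ x : ZMod q, (χ x).im = 0) (u : (ZMod q)ˣ) : χ u = 1 ∨ χ u = -1 := by
  have h1 : ‖χ u‖ = 1 := χ.unit_norm_eq_one u
  have h2 : χ u = ((χ u).re : ℂ) := Complex.ext rfl (by simpa using hreal u)
  rw [h2, Complex.norm_real, Real.norm_eq_abs] at h1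
  rw [h2]
  rcases eq_or_eq_neg_of_abs_eq h1 with h | h
  · left
    simp [h]
  · right
    simp [h]

theorem apply_sq_eq_one_of_real {q : ℕ} {χ : DirichletCharacter ℂ q}
    (hreal : ∀ x : ZMod q, (χ x).im = 0) {v : ZMod q} (hv : IsUnit v) : χ (v ^ 2) = 1 := by
  obtain ⟨u, rfl⟩ := hv
  rw [map_pow]
  rcases eq_one_or_neg_one_of_real hreal u with h | h <;> simp [h]

theorem not_isPrimitive_of_ker {q d : ℕ} [NeZero q] {χ : DirichletCharacter ℂ q} (hd : d ∣ q)
    (hlt : d < q) (hker : ∀ u : (ZMod q)ˣ, ZMod.unitsMap hd u = 1 → χ u = 1) :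
    ¬ χ.IsPrimitive := by
  intro hprim
  have hf : χ.FactorsThrough d := by
    rw [DirichletCharacter.factorsThrough_iff_ker_unitsMap hd]
    intro u hu
    rw [MonoidHom.mem_ker] at hu ⊢
    ext
    simpa using hker u hu
  have : χ.conductor ≤ d := Nat.sInf_le hf
  rw [hprim] at this
  omega

/-- If `2 h = d` and `h² = 0` modulo `q`, where `d` is a proper divisor of `q`, then
`1 + d c = (1 + h c)²`, so that every real character modulo `q` is trivial on the residue classes
congruent to `1` modulo `d`. -/
theorem not_isPrimitive_of_real_of_half {q d h : ℕ} [NeZero q] {χ : DirichletCharacter ℂ q}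
    (hreal : ∀ x : ZMod q, (χ x).im = 0) (hd : d ∣ q) (hlt : d < q)
    (h2 : (2 * h : ZMod q) = d) (hsq : (h : ZMod q) ^ 2 = 0) : ¬ χ.IsPrimitive := by
  refine not_isPrimitive_of_ker hd hlt fun u hu => ?_
  have hc : ∃ c : ℤ, (u : ZMod q) = 1 + d * c := by
    have h1 : ((u : ZMod q).cast : ZMod d) = 1 := by
      rw [← ZMod.unitsMap_val hd, hu, Units.val_one]
    obtain ⟨z, hz⟩ := ZMod.intCast_surjective (u : ZMod q)
    rw [← hz, ZMod.cast_intCast hd, ← Int.cast_one, ZMod.intCast_eq_intCast_iff_dvd_sub] at h1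
    obtain ⟨c, hc⟩ := h1
    refine ⟨-c, ?_⟩
    have : z = 1 + d * -c := by linarith
    rw [← hz, this]
    push_cast
    ring
  obtain ⟨c, hc⟩ := hc
  have hu2 : (u : ZMod q) = (1 + h * c) ^ 2 := by
    rw [hc]
    linear_combination (-(c : ZMod q)) * h2 - (c : ZMod q) ^ 2 * hsq
  have hunit : IsUnit (1 + h * c : ZMod q) := by
    have := u.isUnit
    rw [hu2] at this
    exact (isUnit_pow_iff two_ne_zero).1 this
  rw [hu2]
  exact apply_sq_eq_one_of_real hreal hunit

theorem not_sq_dvd_of_real_of_isPrimitive {q p : ℕ} [NeZero q] {χ : DirichletCharacter ℂ q}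
    (hprim : χ.IsPrimitive) (hreal : ∀ x : ZMod q, (χ x).im = 0) (hodd : Odd p) (hp : 1 < p) :
    ¬ p ^ 2 ∣ q := by
  rintro ⟨m, rfl⟩
  obtain ⟨k, hk⟩ := hodd
  have hm : 0 < m := Nat.pos_of_ne_zero fun h => NeZero.ne (p ^ 2 * m) (by simp [h])
  have hpm : p * m ∣ p ^ 2 * m := ⟨p, by ring⟩
  have hz : ((p ^ 2 * m : ℕ) : ZMod (p ^ 2 * m)) = 0 := ZMod.natCast_self _
  have hk' : (p : ZMod (p ^ 2 * m)) = 2 * k + 1 := by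
    have := congrArg (Nat.cast (R := ZMod (p ^ 2 * m))) hk
    push_cast at this
    exact this
  push_cast at hz
  refine not_isPrimitive_of_real_of_half (d := p * m) (h := p * m * (k + 1)) hreal hpm ?_ ?_ ?_ hprim
  · have : 0 < p * m := by positivity
    nlinarith
  · push_cast
    linear_combination hz - (p * m : ZMod (p ^ 2 * m)) * hk'
  · push_cast
    linear_combination (m * (k + 1) ^ 2 : ZMod (p ^ 2 * m)) * hz

theorem not_sixteen_dvd_of_real_of_isPrimitive {q : ℕ} [NeZero q] {χ : DirichletCharacter ℂ q}
    (hprim : χ.IsPrimitive) (hreal : ∀ x : ZMod q, (χ x).im = 0) : ¬ 16 ∣ q := by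
  rintro ⟨m, rfl⟩
  have hm : 0 < m := Nat.pos_of_ne_zero fun h => NeZero.ne (16 * m) (by simp [h])
  have hz : ((16 * m : ℕ) : ZMod (16 * m)) = 0 := ZMod.natCast_self _
  push_cast at hz
  refine not_isPrimitive_of_real_of_half (d := 8 * m) (h := 4 * m) hreal ⟨2, by ring⟩ (by omega)
    ?_ ?_ hprim
  · push_cast
    ring
  · push_cast
    linear_combination (m : ZMod (16 * m)) * hz

theorem ne_one_of_isPrimitive {q : ℕ} (hq : 1 < q) {χ : DirichletCharacter ℂ q}
    (hprim : χ.IsPrimitive) : χ ≠ 1 := by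
  have : NeZero q := ⟨by omega⟩
  rintro rfl
  rw [DirichletCharacter.isPrimitive_def, DirichletCharacter.conductor_one] at hprim
  omega

theorem eq_quadraticChar_of_real {p : ℕ} [Fact p.Prime] {χ : DirichletCharacter ℂ p}
    (hreal : ∀ x : ZMod p, (χ x).im = 0) (hne : χ ≠ 1) (a : ZMod p) :
    χ a = (quadraticChar (ZMod p) a : ℂ) := by
  -- `χ` is trivial on squares, and one nonsquare with `χ u = -1` determines it on all nonsquares
  obtain ⟨u, hu⟩ := MulChar.ne_one_iff.1 hne
  have hsq : ∀ x : ZMod p, x ≠ 0 → IsSquare x → χ x = 1 := by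
    rintro x hx ⟨v, rfl⟩
    rw [← sq]
    exact apply_sq_eq_one_of_real hreal (isUnit_iff_ne_zero.2 (left_ne_zero_of_mul hx))
  have hu1 : χ u = -1 := (eq_one_or_neg_one_of_real hreal u).resolve_left hu
  by_cases ha : a = 0
  · rw [ha, MulChar.map_nonunit χ not_isUnit_zero]
    simp
  rcases quadraticChar_dichotomy ha with h | h
  · rw [h, hsq a ha ((quadraticChar_one_iff_isSquare ha).1 h)]
    simp
  · have hu2 : quadraticChar (ZMod p) u = -1 := by
      refine (quadraticChar_dichotomy u.ne_zero).resolve_left fun h1 => hu ?_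
      exact hsq u u.ne_zero ((quadraticChar_one_iff_isSquare u.ne_zero).1 h1)
    have hau : (a * u : ZMod p) ≠ 0 := mul_ne_zero ha u.ne_zero
    have h3 := hsq _ hau ((quadraticChar_one_iff_isSquare hau).1 (by rw [map_mul, h, hu2]; norm_num))
    rw [map_mul, hu1] at h3
    rw [h]
    push_cast
    linear_combination -h3

/-! ### The sign of the Gauss sum of a real primitive character -/

theorem jacobiSym_mul_self_complex {a : ℤ} {b : ℕ} (h : a.gcd b = 1) :
    ((jacobiSym a b : ℤ) : ℂ) * jacobiSym a b = 1 := by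
  have := jacobiSym.sq_one h
  rw [sq] at this
  exact_mod_cast this

/-- For odd `q` the only real primitive character modulo `q` is the Jacobi symbol. Its Gauss sum is
computed by splitting off one prime at a time: the signs from twisted multiplicativity are accounted
for by quadratic reciprocity. -/
theorem jacobiSym_and_gaussSum_of_odd (q : ℕ) [hq0 : NeZero q] (hq : Odd q) (χ : DirichletCharacter ℂ q)
    (hprim : χ.IsPrimitive) (hreal : ∀ x : ZMod q, (χ x).im = 0) :
    (∀ a : ℤ, χ a = (jacobiSym a q : ℂ)) ∧ gaussSum χ ZMod.stdAddChar =
      (if q % 4 = 1 then 1 else Complex.I) * (Real.sqrt q : ℂ) := by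
  induction q using Nat.strong_induction_on generalizing hq0 with
  | _ q ih =>
  rcases eq_or_ne q 1 with rfl | hq1
  · rw [DirichletCharacter.level_one χ]
    refine ⟨fun a => ?_, ?_⟩
    · rw [MulChar.one_apply (isUnit_of_subsingleton _), jacobiSym.one_right]
      simp
    · rw [gaussSum, sum_zmod_eq_sum_range, Finset.sum_range_one, Nat.cast_zero,
        AddChar.map_zero_eq_one, MulChar.one_apply (isUnit_of_subsingleton _)]
      simp
  set p := q.minFac with hp
  have hpp : p.Prime := Nat.minFac_prime hq1
  have hpo : Odd p := hq.of_dvd_nat (Nat.minFac_dvd q)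
  obtain ⟨m, hm⟩ : p ∣ q := Nat.minFac_dvd q
  clear_value p
  subst hm
  have hmo : Odd m := hq.of_dvd_nat (dvd_mul_left m p)
  have hpm : p.Coprime m := by
    rw [hpp.coprime_iff_not_dvd]
    rintro ⟨k, rfl⟩
    exact not_sq_dvd_of_real_of_isPrimitive hprim hreal hpo hpp.one_lt ⟨k, by ring⟩
  have : NeZero m := ⟨hmo.pos.ne'⟩
  have : Fact p.Prime := ⟨hpp⟩
  have hp2 : p ≠ 2 := by
    rintro rfl
    exact absurd hpo (by decide)
  obtain ⟨χ₁, χ₂, hfac, hprim₁, hprim₂, hreal₁, hreal₂⟩ :=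
    exists_factorization_of_coprime hpm hprim hreal
  have hχ₁ := eq_quadraticChar_of_real hreal₁ (ne_one_of_isPrimitive hpp.one_lt hprim₁)
  have hG₁ := gaussSum_eq_of_eq_quadraticChar hp2 hχ₁
  have hJ₁ : ∀ a : ℤ, χ₁ a = (jacobiSym a p : ℂ) := by
    intro a
    rw [hχ₁, ← jacobiSym.legendreSym.to_jacobiSym, legendreSym]
  obtain ⟨hJ₂, hG₂⟩ := ih m (by nlinarith [hpp.two_le, hmo.pos]) hmo χ₂ hprim₂ hreal₂
  refine ⟨fun a => ?_, ?_⟩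
  · rw [hfac, hJ₁, hJ₂, jacobiSym.mul_right]
    push_cast
    rfl
  · rw [gaussSum_mul_of_coprime hpm hfac, hG₁, hG₂]
    have e1 := hJ₁ m
    have e2 := hJ₂ p
    rw [Int.cast_natCast] at e1 e2
    rw [e1, e2]
    have hs : (Real.sqrt ((p * m : ℕ) : ℝ) : ℂ) = Real.sqrt p * Real.sqrt m := by
      push_cast
      rw [Real.sqrt_mul (Nat.cast_nonneg p)]
      push_cast
      rfl
    rw [hs]
    have hcop : ((p : ℤ)).gcd m = 1 := by simpa using hpm
    have hsq := jacobiSym_mul_self_complex hcop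
    have hp4 : p % 4 = 1 ∨ p % 4 = 3 := Nat.odd_mod_four_iff.1 (Nat.odd_iff.1 hpo)
    have hm4 : m % 4 = 1 ∨ m % 4 = 3 := Nat.odd_mod_four_iff.1 (Nat.odd_iff.1 hmo)
    rcases hp4 with hp4 | hp4
    · have hr : jacobiSym m p = jacobiSym p m :=
        jacobiSym.quadratic_reciprocity_one_mod_four' hmo hp4
      have hpm4 : p * m % 4 = m % 4 := by rw [Nat.mul_mod, hp4, one_mul, Nat.mod_mod]
      rw [hr, hsq, hpm4, hp4]
      simp only [if_true]
      ring
    rcases hm4 with hm4 | hm4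
    · have hr : jacobiSym m p = jacobiSym p m :=
        jacobiSym.quadratic_reciprocity_one_mod_four hm4 hpo
      rw [hr, hsq, Nat.mul_mod, hp4, hm4]
      norm_num
      ring
    · have hr : jacobiSym m p = -jacobiSym p m :=
        jacobiSym.quadratic_reciprocity_three_mod_four hm4 hp4
      rw [hr, Nat.mul_mod, hp4, hm4]
      push_cast
      rw [neg_mul, hsq]
      norm_num
      linear_combination (-(Real.sqrt p : ℂ) * Real.sqrt m) * Complex.I_sq

theorem stdAddChar_four_one : (ZMod.stdAddChar (1 : ZMod 4) : ℂ) = Complex.I := by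
  have h := ZMod.stdAddChar_coe (N := 4) 1
  rw [Int.cast_one] at h
  rw [h]
  conv_rhs => rw [← Complex.exp_pi_div_two_mul_I]
  congr 1
  push_cast
  ring

theorem stdAddChar_eight_one :
    (ZMod.stdAddChar (1 : ZMod 8) : ℂ) = Real.sqrt 2 / 2 * (1 + Complex.I) := by
  have h := ZMod.stdAddChar_coe (N := 8) 1
  rw [Int.cast_one] at h
  have e : (2 * Real.pi * Complex.I * ((1 : ℤ) : ℂ) / ((8 : ℕ) : ℂ)) =
      ((Real.pi / 4 : ℝ) : ℂ) * Complex.I := by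
    push_cast
    ring
  rw [Int.cast_one] at e
  rw [h, Int.cast_one, e, Complex.exp_mul_I, ← Complex.ofReal_cos, ← Complex.ofReal_sin,
    Real.cos_pi_div_four, Real.sin_pi_div_four]
  push_cast
  ring

theorem stdAddChar_natCast {N : ℕ} [NeZero N] (k : ℕ) :
    (ZMod.stdAddChar (k : ZMod N) : ℂ) = ZMod.stdAddChar (1 : ZMod N) ^ k := by
  rw [← AddChar.map_nsmul_eq_pow, nsmul_one]

theorem apply_of_isPrimitive_four {χ : DirichletCharacter ℂ 4} (hprim : χ.IsPrimitive)
    (hreal : ∀ x : ZMod 4, (χ x).im = 0) : χ 3 = -1 := by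
  have h1 : (ZMod.unitOfCoprime 3 (by decide : Nat.Coprime 3 4) : ZMod 4) = 3 := rfl
  have h := eq_one_or_neg_one_of_real hreal (ZMod.unitOfCoprime 3 (by decide : Nat.Coprime 3 4))
  rw [h1] at h
  refine h.resolve_left fun h3 => ?_
  refine not_isPrimitive_of_ker (one_dvd 4) (by norm_num) (fun u _ => ?_) hprim
  have hu : (u : ZMod 4) = 1 ∨ (u : ZMod 4) = 3 := by
    revert u
    decide
  rcases hu with hu | hu <;> rw [hu]
  · exact map_one χ
  · exact h3

theorem gaussSum_four {χ : DirichletCharacter ℂ 4} (h3 : χ 3 = -1) :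
    gaussSum χ ZMod.stdAddChar = 2 * Complex.I := by
  have h0 : χ 0 = 0 := MulChar.map_nonunit _ (by decide)
  have h2 : χ 2 = 0 := MulChar.map_nonunit _ (by decide)
  rw [gaussSum, sum_zmod_eq_sum_range]
  simp_rw [stdAddChar_natCast, stdAddChar_four_one]
  simp only [Finset.sum_range_succ, Finset.sum_range_zero, Nat.cast_zero, Nat.cast_one,
    Nat.cast_ofNat, h0, h2, h3, map_one]
  linear_combination (-Complex.I) * Complex.I_sq

/-- Primitivity modulo `8` forces `χ 5 = -1`, since `1` and `5` are the classes congruent to `1` modulo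
`4`. -/
theorem apply_of_isPrimitive_eight {χ : DirichletCharacter ℂ 8} (hprim : χ.IsPrimitive)
    (hreal : ∀ x : ZMod 8, (χ x).im = 0) :
    (χ 3 = 1 ∨ χ 3 = -1) ∧ χ 5 = -1 ∧ χ 7 = -χ 3 := by
  have h1 : (ZMod.unitOfCoprime 3 (by decide : Nat.Coprime 3 8) : ZMod 8) = 3 := rfl
  have h := eq_one_or_neg_one_of_real hreal (ZMod.unitOfCoprime 3 (by decide : Nat.Coprime 3 8))
  rw [h1] at h
  have h1' : (ZMod.unitOfCoprime 5 (by decide : Nat.Coprime 5 8) : ZMod 8) = 5 := rfl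
  have h' := eq_one_or_neg_one_of_real hreal (ZMod.unitOfCoprime 5 (by decide : Nat.Coprime 5 8))
  rw [h1'] at h'
  have h5 : χ 5 = -1 := by
    refine h'.resolve_left fun h5 => ?_
    refine not_isPrimitive_of_ker (by norm_num : 4 ∣ 8) (by norm_num) (fun u hu => ?_) hprim
    have hu' : (u : ZMod 8) = 1 ∨ (u : ZMod 8) = 5 := by
      have h2 : ((u : ZMod 8).cast : ZMod 4) = 1 := by
        rw [← ZMod.unitsMap_val (by norm_num : 4 ∣ 8), hu, Units.val_one]
      generalize (u : ZMod 8) = x at h2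
      revert x
      decide
    rcases hu' with hu | hu <;> rw [hu]
    · exact map_one χ
    · exact h5
  refine ⟨h, h5, ?_⟩
  rw [show (7 : ZMod 8) = 3 * 5 by decide, map_mul, h5]
  ring

theorem gaussSum_eight {χ : DirichletCharacter ℂ 8} (h5 : χ 5 = -1) (h7 : χ 7 = -χ 3) :
    gaussSum χ ZMod.stdAddChar = Real.sqrt 2 * (1 + Complex.I) * (1 + χ 3 * Complex.I) := by
  have h0 : χ 0 = 0 := MulChar.map_nonunit _ (by decide)
  have h2 : χ 2 = 0 := MulChar.map_nonunit _ (by decide)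
  have h4 : χ 4 = 0 := MulChar.map_nonunit _ (by decide)
  have h6 : χ 6 = 0 := MulChar.map_nonunit _ (by decide)
  have hsq : (ZMod.stdAddChar (1 : ZMod 8) : ℂ) ^ 2 = Complex.I := by
    have hs : (Real.sqrt 2 : ℂ) ^ 2 = 2 := by
      rw [← Complex.ofReal_pow, Real.sq_sqrt zero_le_two]
      norm_num
    rw [stdAddChar_eight_one]
    linear_combination (1 / 4 * (1 + Complex.I) ^ 2) * hs + (1 / 2) * Complex.I_sq
  rw [gaussSum, sum_zmod_eq_sum_range]
  simp_rw [stdAddChar_natCast]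
  simp only [Finset.sum_range_succ, Finset.sum_range_zero, Nat.cast_zero, Nat.cast_one,
    Nat.cast_ofNat, h0, h2, h4, h5, h6, h7, map_one]
  have hω := stdAddChar_eight_one
  set ω : ℂ := ZMod.stdAddChar (1 : ZMod 8)
  have e3 : ω ^ 3 = Complex.I * ω := by rw [← hsq]; ring
  have e5 : ω ^ 5 = -ω := by linear_combination (ω * (ω ^ 2 + Complex.I)) * hsq + ω * Complex.I_sq
  have e7 : ω ^ 7 = -Complex.I * ω := by
    linear_combination ω ^ 2 * e5 - ω * hsq
  rw [e3, e5, e7, hω]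
  ring

theorem apply_neg_one_of_odd {q : ℕ} (hq : Odd q) {χ : DirichletCharacter ℂ q}
    (hJ : ∀ a : ℤ, χ a = (jacobiSym a q : ℂ)) :
    χ (-1) = if q % 4 = 1 then 1 else -1 := by
  have h := hJ (-1)
  rw [Int.cast_neg, Int.cast_one, jacobiSym.at_neg_one hq] at h
  rw [h]
  rcases Nat.odd_mod_four_iff.1 (Nat.odd_iff.1 hq) with h4 | h4
  · rw [ZMod.χ₄_nat_one_mod_four h4]
    simp [h4]
  · rw [ZMod.χ₄_nat_three_mod_four h4]
    simp [h4]

/-- The Gauss sum of a real primitive character modulo `q` is `√q` for an even character and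
`i√q` for an odd one. -/
theorem gaussSum_of_real_of_isPrimitive {q : ℕ} [NeZero q] {χ : DirichletCharacter ℂ q}
    (hprim : χ.IsPrimitive) (hreal : ∀ x : ZMod q, (χ x).im = 0) :
    (χ (-1) = 1 ∧ gaussSum χ ZMod.stdAddChar = (Real.sqrt q : ℂ)) ∨
      (χ (-1) = -1 ∧ gaussSum χ ZMod.stdAddChar = Complex.I * (Real.sqrt q : ℂ)) := by
  rcases Nat.even_or_odd q with heven | hodd
  swap
  · obtain ⟨hJ, hG⟩ := jacobiSym_and_gaussSum_of_odd q hodd χ hprim hreal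
    rw [apply_neg_one_of_odd hodd hJ, hG]
    split_ifs <;> simp
  have h16 := not_sixteen_dvd_of_real_of_isPrimitive hprim hreal
  obtain ⟨m, hmo, hm⟩ : ∃ m, Odd m ∧ (q = 2 * m ∨ q = 4 * m ∨ q = 8 * m) := by
    obtain ⟨k, hk⟩ := heven
    by_cases h1 : Odd (q / 2)
    · exact ⟨q / 2, h1, by omega⟩
    by_cases h2 : Odd (q / 4)
    · refine ⟨q / 4, h2, ?_⟩
      rw [Nat.odd_iff] at *
      omega
    · refine ⟨q / 8, ?_, ?_⟩ <;> simp only [Nat.odd_iff] at * <;> omega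
  have : NeZero m := ⟨hmo.pos.ne'⟩
  rcases hm with rfl | rfl | rfl
  · have hcop : Nat.Coprime 2 m := Nat.coprime_two_left.2 hmo
    obtain ⟨χ₁, χ₂, hfac, hprim₁, hprim₂, hreal₁, hreal₂⟩ :=
      exists_factorization_of_coprime hcop hprim hreal
    -- there is no primitive character modulo `2`
    refine absurd hprim₁ (not_isPrimitive_of_ker (one_dvd 2) (by norm_num) fun u _ => ?_)
    have hu : (u : ZMod 2) = 1 := by
      revert u
      decide
    rw [hu, map_one]
  · have hcop : Nat.Coprime 4 m := (Nat.coprime_two_left.2 hmo).pow_left 2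
    obtain ⟨χ₁, χ₂, hfac, hprim₁, hprim₂, hreal₁, hreal₂⟩ :=
      exists_factorization_of_coprime hcop hprim hreal
    obtain ⟨hJ, hG⟩ := jacobiSym_and_gaussSum_of_odd m hmo χ₂ hprim₂ hreal₂
    have h3 := apply_of_isPrimitive_four hprim₁ hreal₁
    have hneg := hfac (-1)
    rw [Int.cast_neg, Int.cast_one, Int.cast_neg, Int.cast_one, Int.cast_neg, Int.cast_one,
      apply_neg_one_of_odd hmo hJ, show (-1 : ZMod 4) = 3 by decide, h3] at hneg
    have h4 : χ₂ ((4 : ℕ) : ZMod m) = 1 := by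
      rw [show ((4 : ℕ) : ZMod m) = 2 ^ 2 by norm_num]
      refine apply_sq_eq_one_of_real hreal₂ ?_
      have := (ZMod.isUnit_iff_coprime 2 m).2 (Nat.coprime_two_left.2 hmo)
      simpa using this
    have hs : (Real.sqrt ((4 * m : ℕ) : ℝ) : ℂ) = 2 * Real.sqrt m := by
      rw [Nat.cast_mul, Real.sqrt_mul (Nat.cast_nonneg 4),
        show ((4 : ℕ) : ℝ) = 2 ^ 2 by norm_num, Real.sqrt_sq zero_le_two]
      push_cast
      rfl
    rw [hneg, gaussSum_mul_of_coprime hcop hfac, hG, gaussSum_four h3, h4, hs]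
    rcases Nat.odd_mod_four_iff.1 (Nat.odd_iff.1 hmo) with hm4 | hm4
    · right
      have hm' : ((m : ℕ) : ZMod 4) = 1 := by
        rw [← ZMod.natCast_mod, hm4, Nat.cast_one]
      rw [hm', map_one]
      simp only [hm4, if_true]
      constructor <;> ring
    · left
      have hm' : ((m : ℕ) : ZMod 4) = 3 := by
        rw [← ZMod.natCast_mod, hm4]
        rfl
      rw [hm', h3]
      simp only [hm4]
      norm_num
      linear_combination (-2 * (Real.sqrt m : ℂ)) * Complex.I_sq
  · have hcop : Nat.Coprime 8 m := (Nat.coprime_two_left.2 hmo).pow_left 3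
    obtain ⟨χ₁, χ₂, hfac, hprim₁, hprim₂, hreal₁, hreal₂⟩ :=
      exists_factorization_of_coprime hcop hprim hreal
    obtain ⟨hJ, hG⟩ := jacobiSym_and_gaussSum_of_odd m hmo χ₂ hprim₂ hreal₂
    obtain ⟨h3, h5, h7⟩ := apply_of_isPrimitive_eight hprim₁ hreal₁
    have hneg := hfac (-1)
    rw [Int.cast_neg, Int.cast_one, Int.cast_neg, Int.cast_one, Int.cast_neg, Int.cast_one,
      apply_neg_one_of_odd hmo hJ, show (-1 : ZMod 8) = 7 by decide, h7] at hneg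
    have h8 : χ₂ ((8 : ℕ) : ZMod m) = (ZMod.χ₈ (m : ZMod 8) : ℂ) := by
      have hu := (ZMod.isUnit_iff_coprime 2 m).2 (Nat.coprime_two_left.2 hmo)
      have h2 := hJ 2
      rw [jacobiSym.at_two hmo] at h2
      rw [show ((8 : ℕ) : ZMod m) = 2 ^ 2 * 2 by norm_num, map_mul,
        apply_sq_eq_one_of_real hreal₂ (by simpa using hu), one_mul]
      simpa using h2
    have hs : (Real.sqrt ((8 * m : ℕ) : ℝ) : ℂ) = 2 * Real.sqrt 2 * Real.sqrt m := by
      rw [Nat.cast_mul, Real.sqrt_mul (Nat.cast_nonneg 8),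
        show ((8 : ℕ) : ℝ) = 2 ^ 2 * 2 by norm_num, Real.sqrt_mul (by positivity),
        Real.sqrt_sq zero_le_two]
      push_cast
      rfl
    rw [hneg, gaussSum_mul_of_coprime hcop hfac, hG, gaussSum_eight h5 h7, h8, hs,
      ← ZMod.natCast_mod m 8]
    have hm8 : m % 8 = 1 ∨ m % 8 = 3 ∨ m % 8 = 5 ∨ m % 8 = 7 := by
      rw [Nat.odd_iff] at hmo
      omega
    have x3 : ZMod.χ₈ 3 = -1 := rfl
    have x5 : ZMod.χ₈ 5 = -1 := rfl
    have x7 : ZMod.χ₈ 7 = 1 := rfl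
    rcases h3 with h3 | h3
    · rw [h3, show (Real.sqrt 2 : ℂ) * (1 + Complex.I) * (1 + 1 * Complex.I) =
        2 * Real.sqrt 2 * Complex.I by linear_combination (Real.sqrt 2 : ℂ) * Complex.I_sq]
      rcases hm8 with h | h | h | h
      · have hm4 : m % 4 = 1 := by omega
        right
        simp only [h, hm4, if_true, Nat.cast_one, map_one]
        norm_num
        ring
      · have hm4 : m % 4 = 3 := by omega
        left
        simp only [h, hm4, Nat.cast_ofNat, h3, x3]
        norm_num
        linear_combination (-2 * Real.sqrt 2 * Real.sqrt m : ℂ) * Complex.I_sq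
      · have hm4 : m % 4 = 1 := by omega
        right
        simp only [h, hm4, if_true, Nat.cast_ofNat, h5, x5]
        norm_num
        ring
      · have hm4 : m % 4 = 3 := by omega
        left
        simp only [h, hm4, Nat.cast_ofNat, h3, h7, x7]
        norm_num
        linear_combination (-2 * Real.sqrt 2 * Real.sqrt m : ℂ) * Complex.I_sq
    · rw [h3, show (Real.sqrt 2 : ℂ) * (1 + Complex.I) * (1 + -1 * Complex.I) =
        2 * Real.sqrt 2 by linear_combination (-Real.sqrt 2 : ℂ) * Complex.I_sq]
      rcases hm8 with h | h | h | h
      · have hm4 : m % 4 = 1 := by omega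
        left
        simp [h, hm4]
      · have hm4 : m % 4 = 3 := by omega
        right
        simp only [h, hm4, Nat.cast_ofNat, h3, x3]
        norm_num
        ring
      · have hm4 : m % 4 = 1 := by omega
        left
        simp [h, hm4, h5, x5]
      · have hm4 : m % 4 = 3 := by omega
        right
        simp only [h, hm4, Nat.cast_ofNat, h3, h7, x7]
        norm_num
        ring

/-! ### Summation against a real primitive character -/

/-- A real primitive character is, up to its Gauss sum, its own finite Fourier transform. -/
theorem sum_apply_mul_stdAddChar {q : ℕ} [NeZero q] {χ : DirichletCharacter ℂ q}
    (hprim : χ.IsPrimitive) (hreal : ∀ x : ZMod q, (χ x).im = 0) (n : ZMod q) :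
    ∑ k : ZMod q, χ k * ZMod.stdAddChar (n * k) = χ n * gaussSum χ ZMod.stdAddChar := by
  have hinv : χ⁻¹ = χ := by
    ext u
    rw [MulChar.inv_apply_eq_inv']
    rcases eq_one_or_neg_one_of_real hreal u with h | h <;> simp [h]
  have h := gaussSum_mulShift_of_isPrimitive ZMod.stdAddChar hprim n
  rw [hinv] at h
  rw [← h]
  rfl

theorem sum_Icc_eq_sum_zmod {q : ℕ} (hq : 1 < q) [NeZero q] {f : ℕ → ℂ} {F : ZMod q → ℂ}
    (h0 : F 0 = 0) (hF : ∀ k ∈ Finset.Icc 1 (q - 1), f k = F k) :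
    ∑ k ∈ Finset.Icc 1 (q - 1), f k = ∑ x : ZMod q, F x := by
  rw [sum_zmod_eq_sum_range, Finset.sum_congr rfl hF, Finset.range_eq_Ico,
    Finset.sum_eq_sum_Ico_succ_bot (by omega)]
  simp only [Nat.cast_zero, h0, zero_add]
  refine Finset.sum_congr ?_ fun _ _ => rfl
  ext k
  simp only [Finset.mem_Icc, Finset.mem_Ico]
  omega

/-- The Fourier series of `exp`, summed against `χ` over the points `k / q`. -/
theorem tendsto_gaussSum_mul_sum {q : ℕ} (hq : 1 < q) [NeZero q] {χ : DirichletCharacter ℂ q}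
    (hprim : χ.IsPrimitive) (hreal : ∀ x : ZMod q, (χ x).im = 0) :
    Tendsto (fun N : ℕ => gaussSum χ ZMod.stdAddChar * ((Real.exp 1 : ℂ) - 1) *
        ∑ n ∈ Finset.Icc 1 N, χ (n : ZMod q) * (1 / (1 - 2 * Real.pi * Complex.I * n) +
          χ (-1) / (1 + 2 * Real.pi * Complex.I * n))) atTop
      (𝓝 (∑ k ∈ Finset.Icc 1 (q - 1), χ (k : ZMod q) * (Real.exp ((k : ℝ) / (q : ℝ)) : ℂ))) := by
  have hχ0 : χ 0 = 0 := χ.map_zero' hq.ne'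
  have h := tendsto_finsetSum (Finset.Icc 1 (q - 1)) fun k hk =>
    (tendsto_symmetric_fourier_sum_exp (x := (k : ℝ) / q) (by
      rw [Finset.mem_Icc] at hk
      have h1 : (0 : ℝ) < k := by exact_mod_cast hk.1
      have h2 : (k : ℝ) < q := by exact_mod_cast (by omega : k < q)
      exact ⟨by positivity, (div_lt_one (h1.trans h2)).2 h2⟩)).const_mul (χ (k : ZMod q))
  refine h.congr fun N => ?_
  have e1 : ∀ (n k : ℕ), Complex.exp (2 * Real.pi * Complex.I * n * ((k : ℝ) / q : ℝ)) =
      ZMod.stdAddChar ((n : ZMod q) * (k : ZMod q)) := by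
    intro n k
    have := ZMod.stdAddChar_coe (N := q) ((n : ℤ) * k)
    push_cast at this
    rw [this]
    congr 1
    push_cast
    ring
  have e2 : ∀ (n k : ℕ), Complex.exp (-(2 * Real.pi * Complex.I * n * ((k : ℝ) / q : ℝ))) =
      ZMod.stdAddChar (-(n : ZMod q) * (k : ZMod q)) := by
    intro n k
    have := ZMod.stdAddChar_coe (N := q) (-(n : ℤ) * k)
    push_cast at this
    rw [this]
    congr 1
    push_cast
    ring
  simp_rw [e1, e2]
  rw [sum_Icc_eq_sum_zmod hq (F := fun k : ZMod q => χ k * (((Real.exp 1 : ℂ) - 1) +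
    ∑ n ∈ Finset.Icc 1 N, (((Real.exp 1 : ℂ) - 1) / (1 - 2 * Real.pi * Complex.I * n) *
        ZMod.stdAddChar ((n : ZMod q) * k) +
      ((Real.exp 1 : ℂ) - 1) / (1 + 2 * Real.pi * Complex.I * n) *
        ZMod.stdAddChar (-(n : ZMod q) * k)))) (by simp [hχ0]) fun k _ => rfl]
  simp_rw [mul_add, Finset.mul_sum, mul_add]
  rw [Finset.sum_add_distrib, ← Finset.sum_mul,
    MulChar.sum_eq_zero_of_ne_one (ne_one_of_isPrimitive hq hprim), zero_mul, zero_add,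
    Finset.sum_comm]
  refine Finset.sum_congr rfl fun n _ => ?_
  rw [Finset.sum_add_distrib]
  simp_rw [mul_left_comm (χ _)]
  rw [← Finset.mul_sum, ← Finset.mul_sum, sum_apply_mul_stdAddChar hprim hreal,
    sum_apply_mul_stdAddChar hprim hreal, ← neg_one_mul (n : ZMod q), map_mul]
  ring

theorem one_add_four_pi_sq_mul_ne_zero (n : ℕ) :
    (1 + 4 * (Real.pi : ℂ) ^ 2 * (n : ℂ) ^ 2) ≠ 0 := by
  have : (0 : ℝ) < 1 + 4 * Real.pi ^ 2 * (n : ℝ) ^ 2 := by positivity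
  exact_mod_cast this.ne'

theorem one_div_one_sub_add_div {n : ℕ} (s : ℂ) :
    1 / (1 - 2 * Real.pi * Complex.I * n) + s / (1 + 2 * Real.pi * Complex.I * n) =
      ((1 + s) + (1 - s) * (2 * Real.pi * Complex.I * n)) /
        (1 + 4 * (Real.pi : ℂ) ^ 2 * (n : ℂ) ^ 2) := by
  have h1 : (1 - 2 * Real.pi * Complex.I * n) * (1 + 2 * Real.pi * Complex.I * n) =
      1 + 4 * (Real.pi : ℂ) ^ 2 * (n : ℂ) ^ 2 := by
    linear_combination (-4 * (Real.pi : ℂ) ^ 2 * (n : ℂ) ^ 2) * Complex.I_sq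
  have h0 := one_add_four_pi_sq_mul_ne_zero n
  rw [← h1] at h0 ⊢
  rw [div_add_div _ _ (left_ne_zero_of_mul h0) (right_ne_zero_of_mul h0)]
  congr 1
  ring

theorem summable_apply_div {q : ℕ} (χ : DirichletCharacter ℂ q) :
    Summable (fun n : ℕ => χ ((n + 1 : ℕ) : ZMod q) /
      (1 + 4 * (Real.pi : ℂ) ^ 2 * ((n + 1 : ℕ) : ℂ) ^ 2)) := by
  have hs : Summable fun n : ℕ => 1 / ((n + 1 : ℕ) : ℝ) ^ 2 :=
    (summable_nat_add_iff 1).2 (Real.summable_one_div_nat_pow.2 one_lt_two)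
  refine Summable.of_norm_bounded hs fun n => ?_
  have h1 : (1 + 4 * (Real.pi : ℂ) ^ 2 * ((n + 1 : ℕ) : ℂ) ^ 2) =
      ((1 + 4 * Real.pi ^ 2 * ((n + 1 : ℕ) : ℝ) ^ 2 : ℝ) : ℂ) := by
    push_cast
    rfl
  rw [norm_div, h1, Complex.norm_real, Real.norm_of_nonneg (by positivity)]
  refine div_le_div₀ zero_le_one (χ.norm_le_one _) (by positivity) ?_
  have h2 : 1 ≤ 4 * Real.pi ^ 2 := by nlinarith [Real.pi_gt_three]
  nlinarith [sq_nonneg ((n + 1 : ℕ) : ℝ)]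

theorem mainTheorem4 (q : ℕ) (hq : 1 < q) (χ : DirichletCharacter ℂ q)
    (hprim : χ.IsPrimitive) (hreal : ∀ a : ZMod q, (χ a).im = 0) :
    (χ (-1) = 1 →
      Summable (fun n : ℕ => χ ((n + 1 : ℕ) : ZMod q) /
        (1 + 4 * (Real.pi : ℂ) ^ 2 * ((n + 1 : ℕ) : ℂ) ^ 2)) ∧
      ∑ k ∈ Finset.Icc 1 (q - 1), χ (k : ZMod q) * (Real.exp ((k : ℝ) / (q : ℝ)) : ℂ) =
        2 * ((Real.exp 1 : ℂ) - 1) * (Real.sqrt (q : ℝ) : ℂ) *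
          ∑' n : ℕ, χ ((n + 1 : ℕ) : ZMod q) /
            (1 + 4 * (Real.pi : ℂ) ^ 2 * ((n + 1 : ℕ) : ℂ) ^ 2)) ∧
    (χ (-1) = -1 →
      ∃ s : ℂ,
        Tendsto (fun N : ℕ => ∑ n ∈ Finset.Icc 1 N, χ (n : ZMod q) * (n : ℂ) /
          (1 + 4 * (Real.pi : ℂ) ^ 2 * (n : ℂ) ^ 2)) atTop (𝓝 s) ∧
        ∑ k ∈ Finset.Icc 1 (q - 1), χ (k : ZMod q) * (Real.exp ((k : ℝ) / (q : ℝ)) : ℂ) =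
          -4 * (Real.pi : ℂ) * ((Real.exp 1 : ℂ) - 1) * (Real.sqrt (q : ℝ) : ℂ) * s) := by
  have : NeZero q := ⟨by omega⟩
  have hG := gaussSum_of_real_of_isPrimitive hprim hreal
  have hlim := tendsto_gaussSum_mul_sum hq hprim hreal
  have hs0 : (Real.sqrt (q : ℝ) : ℂ) ≠ 0 := by
    have : (0 : ℝ) < q := by exact_mod_cast (by omega : 0 < q)
    exact_mod_cast (Real.sqrt_pos.2 this).ne'
  have he0 : ((Real.exp 1 : ℂ) - 1) ≠ 0 := by
    have : Real.exp 1 - 1 ≠ 0 := by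
      have := Real.one_lt_exp_iff.2 one_pos
      linarith
    exact_mod_cast this
  simp_rw [one_div_one_sub_add_div] at hlim
  constructor
  · intro heven
    have hG' : gaussSum χ ZMod.stdAddChar = (Real.sqrt q : ℂ) := by
      rcases hG with h | h
      · exact h.2
      · rw [heven] at h
        norm_num at h
    refine ⟨summable_apply_div χ, ?_⟩
    have h1 := ((summable_apply_div χ).hasSum.tendsto_sum_nat).const_mul
      (2 * ((Real.exp 1 : ℂ) - 1) * (Real.sqrt (q : ℝ) : ℂ))
    refine tendsto_nhds_unique hlim (h1.congr fun N => ?_)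
    have hIcc : Finset.Icc 1 N = Finset.Ico 1 (N + 1) := by
      ext n
      simp only [Finset.mem_Icc, Finset.mem_Ico]
      omega
    rw [hG', heven, hIcc, Finset.sum_Ico_eq_sum_range, Nat.add_sub_cancel, Finset.mul_sum,
      Finset.mul_sum]
    refine Finset.sum_congr rfl fun n _ => ?_
    rw [add_comm 1 n]
    ring
  · intro hodd
    have hG' : gaussSum χ ZMod.stdAddChar = Complex.I * (Real.sqrt q : ℂ) := by
      rcases hG with h | h
      · rw [hodd] at h
        norm_num at h
      · exact h.2
    set A : ℂ := -4 * (Real.pi : ℂ) * ((Real.exp 1 : ℂ) - 1) * (Real.sqrt (q : ℝ) : ℂ) with hA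
    have hA0 : A ≠ 0 := by
      simp only [hA, Ne, mul_eq_zero, not_or]
      refine ⟨⟨⟨by norm_num, by exact_mod_cast Real.pi_ne_zero⟩, he0⟩, hs0⟩
    -- convergence of the series is read off from that of the Fourier sums
    refine ⟨(∑ k ∈ Finset.Icc 1 (q - 1),
      χ (k : ZMod q) * (Real.exp ((k : ℝ) / (q : ℝ)) : ℂ)) / A, ?_, ?_⟩
    · refine (hlim.div_const A).congr fun N => ?_
      rw [div_eq_iff hA0, hG', hodd, Finset.mul_sum, Finset.sum_mul]
      refine Finset.sum_congr rfl fun n _ => ?_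
      rw [hA]
      linear_combination (4 * Real.pi * (Real.sqrt q : ℂ) * ((Real.exp 1 : ℂ) - 1) *
        χ (n : ZMod q) * n / (1 + 4 * (Real.pi : ℂ) ^ 2 * (n : ℂ) ^ 2)) * Complex.I_sq
    · field_simp
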